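/- Let $n,m\ge 1$, and let $R$ be a positive semidefinite matrix on $\mathbb C^n\otimes\mathbb C^m$ (the payoff observable of a two-player zero-sum quantum game). For $B\in\mathbb C^{m\times m}$ put $\Phi(B)=\mathrm{Tr}_{\mathbb C^m}\big(R(\mathbb 1\otimes B^{\top})\big)\in\mathbb C^{n\times n}$, and let $\Phi^\dagger$ be the adjoint of $\Phi$ for the Hilbert–Schmidt inner product $\langle A,B\rangle=\mathrm{Tr}(A^\dagger B)$. A density matrix is a positive semidefinite matrix of trace $1$. Assume that payoffs are normalized so that $0\le\Phi(\sigma)\le\mathbb 1$ for every $m\times m$ density matrix $\sigma$ (for example $0\le R\le\mathbb 1$). Alice's payoff is $u(\rho,\sigma)=\langle\rho,\Phi(\sigma)\rangle$ and Bob's is $-u(\rho,\sigma)$. Let $(\rho^*,\sigma^*)$ be a fully mixed Nash equilibrium: $\rho^*,\sigma^*$ are density matrices of full rank with $u(\rho,\sigma^*)\le u(\rho^*,\sigma^*)\le u(\rho^*,\sigma)$ for all density matrices $\rho,\sigma$. For a step size $\mu\in\mathbb R$ (in particular any $\mu>0$), the matrix multiplicative weights update (MMWU) iterates are $A_0=\mathbb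 1$, $B_0=\mathbb 1$ and, for $j\ge 1$, $$A_j=\exp\Big(\mu\sum_{i=0}^{j-1}\Phi(\sigma_i)\Big),\qquad B_j=\exp\Big(-\mu\sum_{i=0}^{j-1}\Phi^\dagger(\rho_i)\Big),$$ where $\rho_j=A_j/\mathrm{Tr}(A_j)$ and $\sigma_j=B_j/\mathrm{Tr}(B_j)$ for all $j\ge0$. Let $S(\rho\|\sigma)=\mathrm{Tr}\big(\rho(\log\rho-\log\sigma)\big)$ be the quantum relative entropy, and put $\Delta S(\rho^*\|\rho_j)=S(\rho^*\|\rho_j)-S(\rho^*\|\rho_{j-1})$ and $\Delta S(\sigma^*\|\sigma_j)=S(\sigma^*\|\sigma_j)-S(\sigma^*\|\sigma_{j-1})$. Then for every $j\ge 1$ $$\Delta S(\rho^*\|\rho_j)+\Delta S(\sigma^*\|\sigma_j)\ \ge\ \mu e^{-\mu}\,\mathrm{Tr}\big(\rho_j\Phi(\sigma_{j-1})\big)-\mu e^{\mu}\,\mathrm{Tr}\big(\rho_{j-1}\Phi(\sigma_j)\big),$$ $$\Delta S(\rho^*\|\rho_j)+\Delta S(\sigma^*\|\sigma_j)\ \le\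 \mu e^{\mu}\,\mathrm{Tr}\big(\rho_{j-1}\Phi(\sigma_{j-1})\big)-\mu e^{-\mu}\,\mathrm{Tr}\big(\rho_{j-1}\Phi(\sigma_{j-1})\big).$$ -/

import Mathlib

open scoped Kronecker ComplexOrder

/-- `ρ` is a density matrix: positive semidefinite with trace one. -/
def IsDensity {n : Type*} [Fintype n] (ρ : Matrix n n ℂ) : Prop :=
  ρ.PosSemidef ∧ ρ.trace = 1

/-- The Hilbert-Schmidt inner product `⟨A, B⟩ = Tr (A† B)`. -/
def hsInner {n : Type*} [Fintype n] (A B : Matrix n n ℂ) : ℂ :=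
  (A.conjTranspose * B).trace

/-- The partial trace over the second tensor factor. -/
def partialTraceRight {n m : Type*} [Fintype m] (M : Matrix (n × m) (n × m) ℂ) :
    Matrix n n ℂ :=
  Matrix.of fun i j => ∑ k, M (i, k) (j, k)

/-- The super-operator `Φ(B) = Tr_𝓑 (R (𝟙 ⊗ Bᵀ))` of an operator `R` on `ℂⁿ ⊗ ℂᵐ`. -/
def superOp {n m : Type*} [Fintype n] [DecidableEq n] [Fintype m]
    (R : Matrix (n × m) (n × m) ℂ) : Matrix m m ℂ →ₗ[ℂ] Matrix n n ℂ where
  toFun B := partialTraceRight (R * ((1 : Matrix n n ℂ) ⊗ₖ B.transpose))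
  map_add' B C := by
    ext i j
    simp [partialTraceRight, Matrix.kronecker_add, Matrix.mul_add, Finset.sum_add_distrib]
  map_smul' c B := by
    ext i j
    simp [partialTraceRight, Matrix.kronecker_smul, Finset.mul_sum]

/-- The adjoint super-operator `Φ†`, whose `(i, j)` entry at `A` is `⟨Φ(E_{ij}), A⟩`. -/
def superAdjoint {n m : Type*} [Fintype n] [DecidableEq m]
    (Φ : Matrix m m ℂ →ₗ[ℂ] Matrix n n ℂ) : Matrix n n ℂ →ₗ[ℂ] Matrix m m ℂ where
  toFun A := Matrix.of fun i j => hsInner (Φ (Matrix.single i j 1)) A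
  map_add' A B := by
    ext i j
    simp [hsInner, Matrix.mul_add]
  map_smul' c A := by
    ext i j
    simp [hsInner]

/-- `superAdjoint Φ` satisfies the condition that determines the adjoint uniquely. -/
theorem hsInner_superAdjoint {n m : Type*} [Fintype n] [Fintype m] [DecidableEq m]
    (Φ : Matrix m m ℂ →ₗ[ℂ] Matrix n n ℂ) (A : Matrix n n ℂ) (B : Matrix m m ℂ) :
    hsInner A (Φ B) = hsInner (superAdjoint Φ A) B := by
  have hB : Φ B = ∑ i, ∑ j, B i j • Φ (Matrix.single i j 1) := by
    conv_lhs => rw [Matrix.matrix_eq_sum_single B]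
    simp only [map_sum]
    refine Finset.sum_congr rfl fun i _ => Finset.sum_congr rfl fun j _ => ?_
    rw [← map_smul, Matrix.smul_single, smul_eq_mul, mul_one]
  have hstar : ∀ C : Matrix n n ℂ, star (hsInner C A) = hsInner A C := by
    intro C
    simp [hsInner, ← Matrix.trace_conjTranspose, Matrix.conjTranspose_mul]
  have hR : hsInner (superAdjoint Φ A) B =
      ∑ j, ∑ i, hsInner A (Φ (Matrix.single i j 1)) * B i j := by
    simp only [← hstar]
    simp [hsInner, superAdjoint, Matrix.trace, Matrix.mul_apply]
  rw [hR, hB, Finset.sum_comm]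
  simp only [hsInner, Matrix.mul_sum, Matrix.trace_sum, Matrix.mul_smul, Matrix.trace_smul,
    smul_eq_mul, mul_comm]

/-- Alice's expected payoff `u(ρ, σ) = ⟨ρ, Φ(σ)⟩` (a real number for Hermitian `R`, `ρ`, `σ`);
Bob's payoff is `-u(ρ, σ)`. -/
def payoff {n m : Type*} [Fintype n] [DecidableEq n] [Fintype m]
    (R : Matrix (n × m) (n × m) ℂ) (ρ : Matrix n n ℂ) (σ : Matrix m m ℂ) : ℝ :=
  (hsInner ρ (superOp R σ)).re

/-- `(ρ, σ)` is a Nash equilibrium of the zero-sum game with payoff observable `R`: neither Alice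
(payoff `u`) nor Bob (payoff `-u`) gains by a unilateral deviation to another density matrix. -/
def IsNash {n m : Type*} [Fintype n] [DecidableEq n] [Fintype m]
    (R : Matrix (n × m) (n × m) ℂ) (ρ : Matrix n n ℂ) (σ : Matrix m m ℂ) : Prop :=
  IsDensity ρ ∧ IsDensity σ ∧
    (∀ ρ' : Matrix n n ℂ, IsDensity ρ' → payoff R ρ' σ ≤ payoff R ρ σ) ∧
    (∀ σ' : Matrix m m ℂ, IsDensity σ' → -payoff R ρ σ' ≤ -payoff R ρ σ)

/-- A Nash equilibrium in which both density matrices have full rank. -/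
def IsFullyMixedNash {n m : Type*} [Fintype n] [DecidableEq n] [Fintype m]
    (R : Matrix (n × m) (n × m) ℂ) (ρ : Matrix n n ℂ) (σ : Matrix m m ℂ) : Prop :=
  IsNash R ρ σ ∧ ρ.rank = Fintype.card n ∧ σ.rank = Fintype.card m

/-- The quantum relative entropy `S(ρ ‖ σ) = Tr (ρ (log ρ - log σ))` of full-rank density matrices,
the matrix logarithm being given by the functional calculus of Hermitian matrices. (The trace is
real.) -/
noncomputable def quantumRelEntropy {n : Type*} [Fintype n] [DecidableEq n]
    (ρ σ : Matrix n n ℂ) : ℝ :=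
  (ρ * (cfc Real.log ρ - cfc Real.log σ)).trace.re

/-- `A / Tr A`. -/
noncomputable def traceNormalize {n : Type*} [Fintype n] (A : Matrix n n ℂ) : Matrix n n ℂ :=
  (A.trace)⁻¹ • A

/-- The pair of accumulated payoff matrices `∑ i < j, Φ(σ_i)` and `∑ i < j, Φ†(ρ_i)` of the matrix
multiplicative weights update with step size `μ`. -/
noncomputable def mmwuSum {n m : Type*} [Fintype n] [DecidableEq n] [Fintype m] [DecidableEq m]
    (R : Matrix (n × m) (n × m) ℂ) (μ : ℝ) : ℕ → Matrix n n ℂ × Matrix m m ℂ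
  | 0 => (0, 0)
  | j + 1 =>
    ((mmwuSum R μ j).1 +
        superOp R (traceNormalize (NormedSpace.exp (-μ • (mmwuSum R μ j).2))),
      (mmwuSum R μ j).2 +
        superAdjoint (superOp R) (traceNormalize (NormedSpace.exp (μ • (mmwuSum R μ j).1))))

/-- The iterate `A_j`. -/
noncomputable def mmwuA {n m : Type*} [Fintype n] [DecidableEq n] [Fintype m] [DecidableEq m]
    (R : Matrix (n × m) (n × m) ℂ) (μ : ℝ) (j : ℕ) : Matrix n n ℂ :=
  NormedSpace.exp (μ • (mmwuSum R μ j).1)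

/-- The iterate `B_j`. -/
noncomputable def mmwuB {n m : Type*} [Fintype n] [DecidableEq n] [Fintype m] [DecidableEq m]
    (R : Matrix (n × m) (n × m) ℂ) (μ : ℝ) (j : ℕ) : Matrix m m ℂ :=
  NormedSpace.exp (-μ • (mmwuSum R μ j).2)

/-- Alice's state `ρ_j = A_j / Tr A_j`. -/
noncomputable def mmwuRho {n m : Type*} [Fintype n] [DecidableEq n] [Fintype m] [DecidableEq m]
    (R : Matrix (n × m) (n × m) ℂ) (μ : ℝ) (j : ℕ) : Matrix n n ℂ :=
  traceNormalize (mmwuA R μ j)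

/-- Bob's state `σ_j = B_j / Tr B_j`. -/
noncomputable def mmwuSigma {n m : Type*} [Fintype n] [DecidableEq n] [Fintype m] [DecidableEq m]
    (R : Matrix (n × m) (n × m) ℂ) (μ : ℝ) (j : ℕ) : Matrix m m ℂ :=
  traceNormalize (mmwuB R μ j)

theorem mmwu_zero {n m : Type*} [Fintype n] [DecidableEq n] [Fintype m] [DecidableEq m]
    (R : Matrix (n × m) (n × m) ℂ) (μ : ℝ) : mmwuA R μ 0 = 1 ∧ mmwuB R μ 0 = 1 := by
  simp [mmwuA, mmwuB, mmwuSum]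

theorem mmwuSum_eq {n m : Type*} [Fintype n] [DecidableEq n] [Fintype m] [DecidableEq m]
    (R : Matrix (n × m) (n × m) ℂ) (μ : ℝ) (j : ℕ) :
    mmwuSum R μ j = (∑ i ∈ Finset.range j, superOp R (mmwuSigma R μ i),
      ∑ i ∈ Finset.range j, superAdjoint (superOp R) (mmwuRho R μ i)) := by
  induction j with
  | zero => simp [mmwuSum]
  | succ j ih =>
    rw [Finset.sum_range_succ, Finset.sum_range_succ, mmwuSum]
    simp only [Prod.mk.injEq]
    exact ⟨by rw [ih]; simp [mmwuSigma, mmwuB, ih], by rw [ih]; simp [mmwuRho, mmwuA, ih]⟩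

/-- The update rule of Alice: `A_j = exp (μ ∑_{i<j} Φ(σ_i))`. -/
theorem mmwuA_eq {n m : Type*} [Fintype n] [DecidableEq n] [Fintype m] [DecidableEq m]
    (R : Matrix (n × m) (n × m) ℂ) (μ : ℝ) (j : ℕ) :
    mmwuA R μ j =
      NormedSpace.exp (μ • ∑ i ∈ Finset.range j, superOp R (mmwuSigma R μ i)) := by
  rw [mmwuA, mmwuSum_eq]

/-- The update rule of Bob: `B_j = exp (-μ ∑_{i<j} Φ†(ρ_i))`. -/
theorem mmwuB_eq {n m : Type*} [Fintype n] [DecidableEq n] [Fintype m] [DecidableEq m]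
    (R : Matrix (n × m) (n × m) ℂ) (μ : ℝ) (j : ℕ) :
    mmwuB R μ j =
      NormedSpace.exp
        (-μ • ∑ i ∈ Finset.range j, superAdjoint (superOp R) (mmwuRho R μ i)) := by
  rw [mmwuB, mmwuSum_eq]

/-! ### Golden–Thompson inequality. -/

section GoldenThompson

open Filter Topology

namespace Matrix

variable {n : Type*} [Fintype n]

/-! Overall strategy. For a Gibbs state `ρ_H = exp H / Tr exp H`, the relative entropy `S(ρ*‖ρ_H)`
is a constant minus `Tr(ρ* H)` plus `log Tr exp H`. In one update the linear terms of the two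
players change by `∓μ` times the game value, since a fully mixed equilibrium makes each payoff
against it constant (`payoff_left`, `payoff_right`); they cancel. What remains are increments of
`log Tr exp`, which `log_trace_exp_add_sub_le` bounds through Golden–Thompson. Running it forward
from the old states gives the upper bound, backward from the new ones the lower bound. -/

theorem norm_trace_mul_le (A B : Matrix n n ℂ) :
    ‖(A * B).trace‖ ≤ (‖(A * A.conjTranspose).trace‖ + ‖(B.conjTranspose * B).trace‖) / 2 := by
  have h1 : (A * A.conjTranspose).trace = ((∑ i, ∑ j, ‖A i j‖ ^ 2 : ℝ) : ℂ) := by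
    simp [trace, mul_apply, Complex.mul_conj']
  have h2 : (B.conjTranspose * B).trace = ((∑ i, ∑ j, ‖B j i‖ ^ 2 : ℝ) : ℂ) := by
    simp [trace, mul_apply, Complex.conj_mul']
  rw [h1, h2, Complex.norm_of_nonneg (by positivity), Complex.norm_of_nonneg (by positivity),
    ← Finset.sum_add_distrib, Finset.sum_div]
  refine (norm_sum_le _ _).trans (Finset.sum_le_sum fun i _ => ?_)
  rw [diag_apply, mul_apply, ← Finset.sum_add_distrib, Finset.sum_div]
  refine (norm_sum_le _ _).trans (Finset.sum_le_sum fun j _ => ?_)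
  rw [norm_mul]
  linarith [two_mul_le_add_sq ‖A i j‖ ‖B j i‖]

variable [DecidableEq n]

theorem trace_mul_pow_comm {R : Type*} [CommRing R] (A B : Matrix n n R) (k : ℕ) :
    ((A * B) ^ k).trace = ((B * A) ^ k).trace := by
  cases k with
  | zero => simp
  | succ k =>
    have h : SemiconjBy B ((A * B) ^ k) ((B * A) ^ k) :=
      SemiconjBy.pow_right (by simp [SemiconjBy, mul_assoc]) k
    rw [pow_succ, ← mul_assoc, trace_mul_comm, ← mul_assoc, h.eq, mul_assoc, ← pow_succ]

/-- The two claims are proved together because each feeds the other: the first at `X ^ 2` uses the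
second for `X*X` and `XX*`, and the second follows from the first at `P * Q` by cyclicity. -/
theorem norm_trace_pow_two_pow_le (k : ℕ) :
    (∀ X : Matrix n n ℂ,
      ‖(X ^ 2 ^ (k + 1)).trace‖ ≤ ‖((X * X.conjTranspose) ^ 2 ^ k).trace‖) ∧
    (∀ P Q : Matrix n n ℂ, P.IsHermitian → Q.IsHermitian →
      ‖((P * Q) ^ 2 ^ k).trace‖ ≤ ‖(P ^ 2 ^ k * Q ^ 2 ^ k).trace‖) := by
  induction k with
  | zero =>
    refine ⟨fun X => ?_, fun P Q _ _ => by simp⟩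
    have := norm_trace_mul_le X X
    rw [trace_mul_comm X.conjTranspose] at this
    simpa [pow_two] using this
  | succ k ih =>
    obtain ⟨ih1, ih2⟩ := ih
    refine ⟨fun X => ?_, fun P Q hP hQ => ?_⟩
    · have hP : (X.conjTranspose * X).IsHermitian := isHermitian_conjTranspose_mul_self X
      have hQ : (X * X.conjTranspose).IsHermitian := isHermitian_mul_conjTranspose_self X
      have h1 := ih1 (X ^ 2)
      rw [← pow_mul, ← pow_succ'] at h1
      have h2 : X ^ 2 * (X ^ 2).conjTranspose =
          (X * (X * X.conjTranspose)) * X.conjTranspose := by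
        simp [pow_two, mul_assoc]
      rw [h2, trace_mul_pow_comm, ← mul_assoc] at h1
      -- The arithmetic mean suffices: `X*X` and `XX*` have the same power traces.
      refine (h1.trans (ih2 _ _ hP hQ)).trans ((norm_trace_mul_le _ _).trans ?_)
      rw [(hP.pow _).eq, (hQ.pow _).eq, ← pow_add, ← pow_add, ← two_mul, ← pow_succ',
        trace_mul_pow_comm X.conjTranspose]
      linarith
    · have h1 := ih1 (P * Q)
      rw [conjTranspose_mul, hP.eq, hQ.eq, ← mul_assoc, trace_mul_pow_comm (P * Q * Q),
        mul_assoc P, ← mul_assoc P P, ← pow_two, ← pow_two] at h1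
      have h2 := ih2 (P ^ 2) (Q ^ 2) (hP.pow 2) (hQ.pow 2)
      rw [← pow_mul, ← pow_mul, ← pow_succ'] at h2
      exact h1.trans h2

end Matrix

/-- Telescoping; the shifted exponent avoids a truncated `n - 1`. -/
theorem norm_pow_sub_pow_le {A : Type*} [NormedRing A] [NormOneClass A] {a b : A} {c : ℝ}
    (ha : ‖a‖ ≤ c) (hb : ‖b‖ ≤ c) (n : ℕ) :
    ‖a ^ (n + 1) - b ^ (n + 1)‖ ≤ (n + 1) * c ^ n * ‖a - b‖ := by
  induction n with
  | zero => simp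
  | succ n ih =>
    have hc : 0 ≤ c := (norm_nonneg a).trans ha
    have h : a ^ (n + 1 + 1) - b ^ (n + 1 + 1) =
        a * (a ^ (n + 1) - b ^ (n + 1)) + (a - b) * b ^ (n + 1) := by
      rw [pow_succ' a, pow_succ' b (n + 1)]; noncomm_ring
    rw [h]
    calc _ ≤ ‖a‖ * ‖a ^ (n + 1) - b ^ (n + 1)‖ + ‖a - b‖ * ‖b ^ (n + 1)‖ :=
          (norm_add_le _ _).trans (add_le_add (norm_mul_le _ _) (norm_mul_le _ _))
      _ ≤ c * ((n + 1) * c ^ n * ‖a - b‖) + ‖a - b‖ * c ^ (n + 1) := by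
          gcongr
          exact (norm_pow_le b _).trans (pow_le_pow_left₀ (norm_nonneg _) hb _)
      _ = _ := by push_cast; ring

theorem norm_exp_le_exp_norm {A : Type*} [NormedRing A] [NormedAlgebra ℝ A] [CompleteSpace A]
    [NormOneClass A] (x : A) : ‖NormedSpace.exp x‖ ≤ Real.exp ‖x‖ := by
  have h1 := NormedSpace.exp_series_hasSum_exp' (𝕂 := ℝ) x
  have h2 := NormedSpace.exp_series_hasSum_exp' (𝕂 := ℝ) ‖x‖
  rw [← Real.exp_eq_exp_ℝ] at h2
  refine h1.tsum_eq ▸ tsum_of_norm_bounded h2 fun k => ?_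
  rw [norm_smul, smul_eq_mul, Real.norm_of_nonneg (by positivity)]
  gcongr
  exact norm_pow_le x k

/-- The Lie product formula. -/
theorem tendsto_exp_mul_exp_pow {A : Type*} [NormedRing A] [NormedAlgebra ℝ A]
    [CompleteSpace A] [NormOneClass A] (x y : A) :
    Tendsto (fun N : ℕ => (NormedSpace.exp ((N : ℝ)⁻¹ • x) * NormedSpace.exp ((N : ℝ)⁻¹ • y)) ^ N)
      atTop (𝓝 (NormedSpace.exp (x + y))) := by
  -- Both curves agree to first order at `0`, so at `t = 1/N` their difference is `o(1/N)`, which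
  -- beats the factor `N` lost in comparing `N`-th powers.
  have hd : HasDerivAt (fun t : ℝ => NormedSpace.exp (t • x) * NormedSpace.exp (t • y) -
      NormedSpace.exp (t • (x + y))) 0 0 := by
    have h := ((hasDerivAt_exp_smul_const x (0 : ℝ)).mul
      (hasDerivAt_exp_smul_const y (0 : ℝ))).sub (hasDerivAt_exp_smul_const (x + y) (0 : ℝ))
    convert! h using 1
    simp
  have hlim : Tendsto (fun N : ℕ => (N : ℝ) * ‖NormedSpace.exp ((N : ℝ)⁻¹ • x) *
      NormedSpace.exp ((N : ℝ)⁻¹ • y) - NormedSpace.exp ((N : ℝ)⁻¹ • (x + y))‖) atTop (𝓝 0) := by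
    have h := hd.isLittleO.comp_tendsto (tendsto_inv_atTop_nhds_zero_nat (𝕜 := ℝ))
    simp only [zero_smul, NormedSpace.exp_zero, mul_one, sub_self, sub_zero, smul_zero,
      Function.comp_def] at h
    have h' := h.norm_left.tendsto_div_nhds_zero
    simpa [div_eq_mul_inv, mul_comm] using h'
  rw [tendsto_iff_norm_sub_tendsto_zero]
  refine squeeze_zero' (.of_forall fun _ => norm_nonneg _) ?_
    (by simpa using hlim.const_mul (Real.exp (‖x‖ + ‖y‖)))
  filter_upwards [eventually_ge_atTop 1] with N hN
  obtain ⟨k, rfl⟩ := Nat.exists_eq_add_of_le' hN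
  let : NormedAlgebra ℚ A := NormedAlgebra.restrictScalars ℚ ℝ A
  set r : ℝ := ((k + 1 : ℕ) : ℝ)⁻¹ with hr
  have hr0 : 0 ≤ r := by positivity
  have hexp : NormedSpace.exp (x + y) = NormedSpace.exp (r • (x + y)) ^ (k + 1) := by
    rw [← NormedSpace.exp_nsmul, ← Nat.cast_smul_eq_nsmul ℝ, smul_smul, hr,
      mul_inv_cancel₀ (by positivity), one_smul]
  have hx : ‖NormedSpace.exp (r • x) * NormedSpace.exp (r • y)‖ ≤ Real.exp (r * (‖x‖ + ‖y‖)) := by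
    rw [mul_add, Real.exp_add]
    refine (norm_mul_le _ _).trans (mul_le_mul ?_ ?_ (norm_nonneg _) (Real.exp_nonneg _))
    all_goals
      refine (norm_exp_le_exp_norm _).trans_eq ?_
      rw [norm_smul, Real.norm_of_nonneg hr0]
  have hxy : ‖NormedSpace.exp (r • (x + y))‖ ≤ Real.exp (r * (‖x‖ + ‖y‖)) := by
    refine (norm_exp_le_exp_norm _).trans (Real.exp_le_exp.2 ?_)
    rw [norm_smul, Real.norm_of_nonneg hr0]
    exact mul_le_mul_of_nonneg_left (norm_add_le x y) hr0
  rw [hexp]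
  refine (norm_pow_sub_pow_le hx hxy k).trans ?_
  have hc : Real.exp (r * (‖x‖ + ‖y‖)) ^ k ≤ Real.exp (‖x‖ + ‖y‖) := by
    rw [← Real.exp_nat_mul, Real.exp_le_exp, ← mul_assoc]
    refine mul_le_of_le_one_left (by positivity) ?_
    rw [hr, ← div_eq_mul_inv]
    exact div_le_one_of_le₀ (by push_cast; linarith) (by positivity)
  rw [mul_right_comm, mul_comm, Nat.cast_succ]
  gcongr
  rw [smul_add]

open scoped Matrix.Norms.L2Operator in
/-- The Golden–Thompson inequality. -/
theorem Matrix.IsHermitian.norm_trace_exp_add_le {n : Type*} [Fintype n] [DecidableEq n]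
    {H K : Matrix n n ℂ} (hH : H.IsHermitian) (hK : K.IsHermitian) :
    ‖(NormedSpace.exp (H + K)).trace‖ ≤ ‖(NormedSpace.exp H * NormedSpace.exp K).trace‖ := by
  cases isEmpty_or_nonempty n
  · simp
  have hpow : ∀ (k : ℕ) (X : Matrix n n ℂ),
      NormedSpace.exp (((2 ^ k : ℕ) : ℝ)⁻¹ • X) ^ 2 ^ k = NormedSpace.exp X := by
    intro k X
    let : NormedAlgebra ℚ (Matrix n n ℂ) := NormedAlgebra.restrictScalars ℚ ℝ _
    rw [← NormedSpace.exp_nsmul, ← Nat.cast_smul_eq_nsmul ℝ, smul_smul,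
      mul_inv_cancel₀ (by positivity), one_smul]
  have hherm : ∀ (r : ℝ) {X : Matrix n n ℂ}, X.IsHermitian →
      (NormedSpace.exp (r • X)).IsHermitian := fun r X hX =>
    (hX.smul (IsSelfAdjoint.all r)).exp
  have hlim := (tendsto_exp_mul_exp_pow H K).comp
    (tendsto_pow_atTop_atTop_of_one_lt (one_lt_two : 1 < 2))
  have hcont : Continuous fun X : Matrix n n ℂ => ‖X.trace‖ :=
    (continuous_id.matrix_trace).norm
  -- The trace inequality is only available for dyadic powers, so the Lie limit is taken along `N =
  -- 2 ^ k`.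
  refine le_of_tendsto ((hcont.tendsto _).comp hlim) (.of_forall fun k => ?_)
  have h := (norm_trace_pow_two_pow_le k).2 _ _ (hherm ((2 ^ k : ℕ) : ℝ)⁻¹ hH)
    (hherm ((2 ^ k : ℕ) : ℝ)⁻¹ hK)
  rw [hpow, hpow] at h
  exact h

end GoldenThompson

/-! ### Gibbs states: log-partition function and relative entropy. -/

section GibbsState

open scoped MatrixOrder Matrix.Norms.L2Operator

namespace Matrix

variable {n : Type*} [Fintype n] [DecidableEq n]

theorem PosSemidef.trace_mul_nonneg {A B : Matrix n n ℂ} (hA : A.PosSemidef)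
    (hB : B.PosSemidef) : 0 ≤ (A * B).trace := by
  obtain ⟨C, rfl⟩ := CStarAlgebra.nonneg_iff_eq_star_mul_self.1 hB.nonneg
  rw [← mul_assoc, trace_mul_comm, ← mul_assoc]
  exact (hA.mul_mul_conjTranspose_same C).trace_nonneg

theorem posSemidef_exp {H : Matrix n n ℂ} (hH : H.IsHermitian) :
    (NormedSpace.exp H).PosSemidef :=
  nonneg_iff_posSemidef.1 (IsSelfAdjoint.exp_nonneg hH)

theorem posDef_exp {H : Matrix n n ℂ} (hH : H.IsHermitian) : (NormedSpace.exp H).PosDef :=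
  (posSemidef_exp hH).posDef_iff_isUnit.2 (isUnit_exp H)

/-- By functional calculus this is scalar on `[0, 1]`: `exp y - 1 ≤ y exp y` at `y = s x`, then `s x
exp (s x) ≤ s x exp s`. It holds for either sign of `s`, and both signs are needed later. -/
theorem exp_smul_le_one_add {P : Matrix n n ℂ} (h0 : P.PosSemidef) (h1 : (1 - P).PosSemidef)
    (s : ℝ) : NormedSpace.exp (s • P) ≤ 1 + (s * Real.exp s) • P := by
  have hP : IsSelfAdjoint P := h0.isHermitian
  have hspec : ∀ x ∈ spectrum ℝ P, 0 ≤ x ∧ x ≤ 1 := by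
    refine fun x hx => ⟨spectrum_nonneg_of_nonneg h0.nonneg hx, ?_⟩
    have h : P ≤ algebraMap ℝ _ 1 := by rw [map_one]; exact h1
    exact (le_algebraMap_iff_spectrum_le (a := P)).1 h x hx
  have e1 : NormedSpace.exp (s • P) = cfc (fun x => Real.exp (s * x)) P := by
    rw [← CFC.real_exp_eq_normedSpace_exp ((IsSelfAdjoint.all s).smul hP), ← cfc_comp_smul s Real.exp P]
    simp
  have e2 : 1 + (s * Real.exp s) • P = cfc (fun x => 1 + (s * Real.exp s) * x) P := by
    rw [cfc_const_add (1 : ℝ) (fun x => (s * Real.exp s) * x) P, cfc_const_mul_id _ P, map_one]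
  rw [e1, e2]
  refine cfc_mono fun x hx => ?_
  obtain ⟨hx0, hx1⟩ := hspec x hx
  have hmul : s * x * Real.exp (s * x) ≤ s * x * Real.exp s := by
    rcases le_total 0 s with hs | hs
    · exact mul_le_mul_of_nonneg_left (Real.exp_le_exp.2 (mul_le_of_le_one_right hs hx1))
        (mul_nonneg hs hx0)
    · exact mul_le_mul_of_nonpos_left (Real.exp_le_exp.2 (by nlinarith))
        (mul_nonpos_of_nonpos_of_nonneg hs hx0)
  have h2 : Real.exp (s * x) * Real.exp (-(s * x)) = 1 := by
    rw [← Real.exp_add]; simp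
  have h3 := mul_le_mul_of_nonneg_left (Real.add_one_le_exp (-(s * x))) (Real.exp_nonneg (s * x))
  linarith

/-- Golden–Thompson splits the exponential, `exp_smul_le_one_add` linearizes the factor in `P`, and
`log x ≤ x - 1` is applied to the ratio of traces. -/
theorem log_trace_exp_add_sub_le [Nonempty n] {H P : Matrix n n ℂ} (hH : H.IsHermitian)
    (h0 : P.PosSemidef) (h1 : (1 - P).PosSemidef) (s : ℝ) :
    Real.log (NormedSpace.exp (H + s • P)).trace.re - Real.log (NormedSpace.exp H).trace.re ≤
      s * Real.exp s * (traceNormalize (NormedSpace.exp H) * P).trace.re := by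
  have hsP : (s • P).IsHermitian := h0.isHermitian.smul (IsSelfAdjoint.all s)
  have htH := Complex.pos_iff.1 (posDef_exp hH).trace_pos
  have htHP := Complex.pos_iff.1 (posDef_exp (hH.add hsP)).trace_pos
  set t := (NormedSpace.exp H).trace.re with ht
  have htC : (NormedSpace.exp H).trace = (t : ℂ) := Complex.ext rfl htH.2.symm
  have hGT := hH.norm_trace_exp_add_le hsP
  rw [← Complex.re_eq_norm.2 ((posSemidef_exp hH).trace_mul_nonneg (posSemidef_exp hsP))] at hGT
  have hle := (posSemidef_exp hH).trace_mul_nonneg (le_iff.1 (exp_smul_le_one_add h0 h1 s))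
  rw [Matrix.mul_sub, Matrix.trace_sub, mul_add, mul_one, mul_smul_comm, trace_add, trace_smul] at hle
  have hle' := (Complex.nonneg_iff.1 hle).1
  simp only [Complex.sub_re, Complex.add_re, Complex.real_smul, Complex.re_ofReal_mul] at hle'
  have hnorm : (traceNormalize (NormedSpace.exp H) * P).trace.re =
      t⁻¹ * (NormedSpace.exp H * P).trace.re := by
    rw [traceNormalize, htC, smul_mul_assoc, trace_smul, smul_eq_mul, ← Complex.ofReal_inv,
      Complex.re_ofReal_mul]
  rw [hnorm, ← Real.log_div htHP.1.ne' htH.1.ne']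
  refine (Real.log_le_sub_one_of_pos (div_pos htHP.1 htH.1)).trans ?_
  rw [div_sub_one htH.1.ne', div_le_iff₀ htH.1]
  have : s * Real.exp s * (t⁻¹ * (NormedSpace.exp H * P).trace.re) * t =
      s * Real.exp s * (NormedSpace.exp H * P).trace.re := by
    have := htH.1.ne'
    field_simp
  rw [this]
  have := Complex.re_le_norm (NormedSpace.exp (H + s • P)).trace
  linarith

theorem quantumRelEntropy_traceNormalize_exp [Nonempty n] {ρ H : Matrix n n ℂ}
    (hρ : ρ.trace = 1) (hH : H.IsHermitian) :
    quantumRelEntropy ρ (traceNormalize (NormedSpace.exp H)) =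
      (ρ * cfc Real.log ρ).trace.re - (ρ * H).trace.re +
        Real.log (NormedSpace.exp H).trace.re := by
  have htH := Complex.pos_iff.1 (posDef_exp hH).trace_pos
  set t := (NormedSpace.exp H).trace.re with ht
  have htC : (NormedSpace.exp H).trace = (t : ℂ) := Complex.ext rfl htH.2.symm
  have e : traceNormalize (NormedSpace.exp H) = t⁻¹ • NormedSpace.exp H := by
    rw [traceNormalize, htC, ← Complex.ofReal_inv, Complex.coe_smul]
  have hlog : cfc Real.log (traceNormalize (NormedSpace.exp H)) =
      algebraMap ℝ (Matrix n n ℂ) (-Real.log t) + H := by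
    have h := CFC.log_smul' (NormedSpace.exp H) (inv_pos.2 htH.1)
      (isStrictlyPositive_iff_posDef.2 (posDef_exp hH))
    rw [CFC.log_exp H hH, Real.log_inv, ← e] at h
    exact h
  rw [quantumRelEntropy, hlog, Matrix.mul_sub, Matrix.mul_add, trace_sub, trace_add,
    Algebra.algebraMap_eq_smul_one, mul_smul_comm, mul_one, trace_smul, hρ]
  simp
  ring

end Matrix

end GibbsState

/-! ### Payoff maps and fully mixed equilibria. -/

section Game

open scoped MatrixOrder Matrix.Norms.L2Operator

namespace Matrix

variable {n : Type*} [Fintype n]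

theorem trace_mul_vecMulVec_star {R : Type*} [CommSemiring R] [Star R] (M : Matrix n n R)
    (x : n → R) : (M * vecMulVec x (star x)).trace = star x ⬝ᵥ (M *ᵥ x) := by
  rw [mul_vecMulVec, trace_vecMulVec, dotProduct_comm]

/-- Pure states `x x* / ‖x‖²` already test positivity. -/
theorem posSemidef_of_trace_mul_nonneg {M : Matrix n n ℂ} (hM : M.IsHermitian)
    (h : ∀ ρ : Matrix n n ℂ, IsDensity ρ → 0 ≤ (M * ρ).trace) : M.PosSemidef := by
  refine .of_dotProduct_mulVec_nonneg hM fun x => ?_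
  rcases eq_or_ne x 0 with rfl | hx
  · simp
  have ht : 0 < star x ⬝ᵥ x := dotProduct_star_self_pos_iff.2 hx
  have h' := h ((star x ⬝ᵥ x)⁻¹ • vecMulVec x (star x))
    ⟨(posSemidef_vecMulVec_self_star x).smul (inv_nonneg.2 ht.le), by
      rw [trace_smul, trace_vecMulVec, dotProduct_comm x, smul_eq_mul, inv_mul_cancel₀ ht.ne']⟩
  rw [mul_smul_comm, trace_smul, smul_eq_mul, trace_mul_vecMulVec_star] at h'
  have := mul_nonneg ht.le h'
  rwa [mul_inv_cancel_left₀ ht.ne'] at this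

theorem isUnit_of_rank_eq_card {K : Type*} [Field K] [DecidableEq n] {M : Matrix n n K}
    (h : M.rank = Fintype.card n) : IsUnit M := by
  rw [← mulVec_surjective_iff_isUnit, ← coe_mulVecLin, ← LinearMap.range_eq_top]
  exact Submodule.eq_top_of_finrank_eq (by rw [← rank, h, Module.finrank_fintype_fun_eq_card])

end Matrix

open Matrix

theorem isDensity_traceNormalize_exp {n : Type*} [Fintype n] [DecidableEq n] [Nonempty n]
    {H : Matrix n n ℂ} (hH : H.IsHermitian) : IsDensity (traceNormalize (NormedSpace.exp H)) := by
  have ht := (posDef_exp hH).trace_pos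
  refine ⟨(posSemidef_exp hH).smul (inv_nonneg.2 ht.le), ?_⟩
  rw [traceNormalize, trace_smul, smul_eq_mul, inv_mul_cancel₀ ht.ne']

theorem IsDensity.nonempty {n : Type*} [Fintype n] {ρ : Matrix n n ℂ} (h : IsDensity ρ) :
    Nonempty n := by
  by_contra hn
  rw [not_nonempty_iff] at hn
  simpa [trace] using h.2

section Maps

variable {n m : Type*} [Fintype n] [DecidableEq n] [Fintype m] {R : Matrix (n × m) (n × m) ℂ}

theorem superOp_apply (R : Matrix (n × m) (n × m) ℂ)
    (B : Matrix m m ℂ) (i j : n) :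
    superOp R B i j = ∑ k, ∑ l, R (i, k) (j, l) * B k l := by
  simp [superOp, partialTraceRight, mul_apply, Fintype.sum_prod_type, one_apply]

theorem trace_mul_superOp (R : Matrix (n × m) (n × m) ℂ) (A : Matrix n n ℂ) (B : Matrix m m ℂ) :
    (A * superOp R B).trace = (R * (A ⊗ₖ B.transpose)).trace := by
  rw [trace_mul_comm]
  simp only [trace, diag_apply, mul_apply, superOp_apply, Fintype.sum_prod_type, kroneckerMap_apply,
    transpose_apply, Finset.sum_mul]
  refine Finset.sum_congr rfl fun j _ => ?_
  rw [Finset.sum_comm]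
  exact Finset.sum_congr rfl fun k _ => Finset.sum_congr rfl fun i _ =>
    Finset.sum_congr rfl fun l _ => by ring

theorem isHermitian_superOp (hR : R.IsHermitian) {B : Matrix m m ℂ} (hB : B.IsHermitian) :
    (superOp R B).IsHermitian := by
  ext i j
  simp only [conjTranspose_apply, superOp_apply, star_sum, star_mul']
  rw [Finset.sum_comm]
  simp [hR.apply, hB.apply]

variable [DecidableEq m]

theorem posSemidef_superOp (hR : R.PosSemidef) {B : Matrix m m ℂ} (hB : B.PosSemidef) :
    (superOp R B).PosSemidef := by
  refine posSemidef_of_trace_mul_nonneg (isHermitian_superOp hR.1 hB.1) fun ρ hρ => ?_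
  rw [trace_mul_comm, trace_mul_superOp]
  exact hR.trace_mul_nonneg (hρ.1.kronecker hB.transpose)

theorem isHermitian_superAdjoint (hR : R.IsHermitian) {A : Matrix n n ℂ} (hA : A.IsHermitian) :
    (superAdjoint (superOp R) A).IsHermitian := by
  ext k l
  simp only [conjTranspose_apply, superAdjoint, LinearMap.coe_mk, AddHom.coe_mk, of_apply, hsInner]
  rw [← trace_conjTranspose, conjTranspose_mul, conjTranspose_conjTranspose, hA.eq, trace_mul_comm]
  congr 2
  ext i j
  simp only [conjTranspose_apply, superOp_apply]
  simp [single_apply, hR.apply, ite_and]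

theorem trace_superAdjoint_mul (hR : R.IsHermitian) {A : Matrix n n ℂ} (hA : A.IsHermitian)
    (B : Matrix m m ℂ) :
    (superAdjoint (superOp R) A * B).trace = (A * superOp R B).trace := by
  have h := hsInner_superAdjoint (superOp R) A B
  rwa [hsInner, hsInner, hA.eq, (isHermitian_superAdjoint hR hA).eq, eq_comm] at h

theorem posSemidef_superAdjoint (hR : R.PosSemidef) {A : Matrix n n ℂ} (hA : A.PosSemidef) :
    (superAdjoint (superOp R) A).PosSemidef := by
  refine posSemidef_of_trace_mul_nonneg (isHermitian_superAdjoint hR.1 hA.1) fun σ hσ => ?_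
  rw [trace_superAdjoint_mul hR.1 hA.1]
  exact hA.trace_mul_nonneg (posSemidef_superOp hR hσ.1)

/-- The normalization passes to the adjoint because `Tr ((1 - Φ†ρ) σ) = Tr (ρ (1 - Φσ))` for states.
-/
theorem posSemidef_one_sub_superAdjoint (hR : R.PosSemidef)
    (hR1 : ∀ σ : Matrix m m ℂ, IsDensity σ → (1 - superOp R σ).PosSemidef)
    {ρ : Matrix n n ℂ} (hρ : IsDensity ρ) : (1 - superAdjoint (superOp R) ρ).PosSemidef := by
  refine posSemidef_of_trace_mul_nonneg
    (isHermitian_one.sub (isHermitian_superAdjoint hR.1 hρ.1.1)) fun σ hσ => ?_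
  have h := hρ.1.trace_mul_nonneg (hR1 σ hσ)
  rw [Matrix.mul_sub, trace_sub, mul_one, hρ.2] at h
  rwa [Matrix.sub_mul, trace_sub, Matrix.one_mul, hσ.2, trace_superAdjoint_mul hR.1 hρ.1.1]

end Maps

/-- A full-rank state is interior, so the segment from `ρ` to `ρs` extends beyond `ρs`. -/
theorem exists_isDensity_one_add_smul_sub_smul {n : Type*} [Fintype n] [DecidableEq n]
    {ρs ρ : Matrix n n ℂ}
    (hρs : IsDensity ρs) (hrank : ρs.rank = Fintype.card n) (hρ : IsDensity ρ) :
    ∃ ε : ℝ, 0 < ε ∧ IsDensity ((1 + ε) • ρs - ε • ρ) := by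
  have := hρs.nonempty
  have hpd : ρs.PosDef := hρs.1.posDef_iff_isUnit.2 (isUnit_of_rank_eq_card hrank)
  have hsp := isStrictlyPositive_iff_posDef.2 hpd
  obtain ⟨r, hr, hle⟩ := (CFC.exists_pos_algebraMap_le_iff (a := ρs) hpd.1).2
    fun x hx => hsp.spectrum_pos hx
  have hnorm : ρ ≤ algebraMap ℝ _ ‖ρ‖ := IsSelfAdjoint.le_algebraMap_norm_self hρ.1.1
  have hpos : 0 < ‖ρ‖ + 1 := by positivity
  -- With `r` a positive lower bound for `ρs`, this choice gives `ε ρ ≤ r ≤ ρs`.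
  refine ⟨r / (‖ρ‖ + 1), div_pos hr hpos, ?_, ?_⟩
  · have h : (r / (‖ρ‖ + 1)) • ρ ≤ ρs := by
      refine ((smul_le_smul_of_nonneg_left hnorm (div_pos hr hpos).le).trans ?_).trans hle
      rw [Algebra.algebraMap_eq_smul_one, Algebra.algebraMap_eq_smul_one, smul_smul]
      refine smul_le_smul_of_nonneg_right ?_ PosSemidef.one.nonneg
      rw [div_mul_eq_mul_div, div_le_iff₀ hpos]
      nlinarith
    rw [add_smul, one_smul, add_sub_right_comm]
    exact h.add (hρs.1.smul (div_pos hr hpos).le)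
  · simp [trace_sub, trace_smul, hρs.2, hρ.2]

/-- A linear payoff minimized at an interior state is constant: optimality against `σ` and against
the point beyond `σs` gives opposite inequalities. -/
theorem IsFullyMixedNash.payoff_left {n m : Type*} [Fintype n] [DecidableEq n] [Fintype m]
    {R : Matrix (n × m) (n × m) ℂ} {ρs : Matrix n n ℂ} {σs : Matrix m m ℂ}
    (h : IsFullyMixedNash R ρs σs) {σ : Matrix m m ℂ} (hσ : IsDensity σ) :
    (ρs * superOp R σ).trace.re = payoff R ρs σs := by
  classical
  obtain ⟨ε, hε, hd⟩ := exists_isDensity_one_add_smul_sub_smul h.1.2.1 h.2.2 hσ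
  have hp : ∀ τ, payoff R ρs τ = (ρs * superOp R τ).trace.re := fun τ => by
    rw [payoff, hsInner, h.1.1.1.1.eq]
  have h1 := h.1.2.2.2 _ hd
  have h2 := h.1.2.2.2 _ hσ
  simp only [hp, map_sub, LinearMap.map_smul_of_tower, Matrix.mul_sub, trace_sub, mul_smul_comm,
    trace_smul, Complex.sub_re, Complex.real_smul, Complex.re_ofReal_mul] at h1 h2 ⊢
  nlinarith

theorem IsFullyMixedNash.payoff_right {n m : Type*} [Fintype n] [DecidableEq n] [Fintype m]
    {R : Matrix (n × m) (n × m) ℂ} {ρs : Matrix n n ℂ} {σs : Matrix m m ℂ}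
    (h : IsFullyMixedNash R ρs σs) {ρ : Matrix n n ℂ} (hρ : IsDensity ρ) :
    (ρ * superOp R σs).trace.re = payoff R ρs σs := by
  obtain ⟨ε, hε, hd⟩ := exists_isDensity_one_add_smul_sub_smul h.1.1 h.2.1 hρ
  have hp : ∀ τ : Matrix n n ℂ, IsDensity τ → payoff R τ σs = (τ * superOp R σs).trace.re :=
    fun τ hτ => by rw [payoff, hsInner, hτ.1.1.eq]
  have h1 := h.1.2.2.1 _ hd
  have h2 := h.1.2.2.1 _ hρ
  rw [hp _ hd, hp _ h.1.1] at h1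
  rw [hp _ hρ, hp _ h.1.1] at h2
  rw [hp _ h.1.1]
  simp only [Matrix.sub_mul, trace_sub, smul_mul_assoc,
    trace_smul, Complex.sub_re, Complex.real_smul, Complex.re_ofReal_mul] at h1
  nlinarith

end Game

/-! ### The iterates and the entropy bounds. -/

open Matrix in
theorem isHermitian_mmwuSum {n m : Type*} [Fintype n] [DecidableEq n] [Nonempty n] [Fintype m]
    [DecidableEq m] [Nonempty m] {R : Matrix (n × m) (n × m) ℂ} (hR : R.IsHermitian) (μ : ℝ)
    (j : ℕ) : (mmwuSum R μ j).1.IsHermitian ∧ (mmwuSum R μ j).2.IsHermitian := by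
  induction j with
  | zero => exact ⟨isHermitian_zero, isHermitian_zero⟩
  | succ j ih =>
    exact ⟨ih.1.add (isHermitian_superOp hR
        (isDensity_traceNormalize_exp (ih.2.smul (IsSelfAdjoint.all (-μ)))).1.1),
      ih.2.add (isHermitian_superAdjoint hR
        (isDensity_traceNormalize_exp (ih.1.smul (IsSelfAdjoint.all μ))).1.1)⟩

open Matrix in
theorem corollary3p4 {n m : ℕ}
    (R : Matrix (Fin n × Fin m) (Fin n × Fin m) ℂ) (hR : R.PosSemidef)
    (hR1 : ∀ σ : Matrix (Fin m) (Fin m) ℂ, IsDensity σ → (1 - superOp R σ).PosSemidef)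
    (ρs : Matrix (Fin n) (Fin n) ℂ) (σs : Matrix (Fin m) (Fin m) ℂ)
    (hNash : IsFullyMixedNash R ρs σs) (μ : ℝ) (j : ℕ) (hj : 1 ≤ j) :
    μ * Real.exp (-μ) * (mmwuRho R μ j * superOp R (mmwuSigma R μ (j - 1))).trace.re -
        μ * Real.exp μ * (mmwuRho R μ (j - 1) * superOp R (mmwuSigma R μ j)).trace.re ≤
      (quantumRelEntropy ρs (mmwuRho R μ j) - quantumRelEntropy ρs (mmwuRho R μ (j - 1))) +
        (quantumRelEntropy σs (mmwuSigma R μ j) -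
          quantumRelEntropy σs (mmwuSigma R μ (j - 1))) ∧
    (quantumRelEntropy ρs (mmwuRho R μ j) - quantumRelEntropy ρs (mmwuRho R μ (j - 1))) +
        (quantumRelEntropy σs (mmwuSigma R μ j) -
          quantumRelEntropy σs (mmwuSigma R μ (j - 1))) ≤
      μ * Real.exp μ *
          (mmwuRho R μ (j - 1) * superOp R (mmwuSigma R μ (j - 1))).trace.re -
        μ * Real.exp (-μ) *
          (mmwuRho R μ (j - 1) * superOp R (mmwuSigma R μ (j - 1))).trace.re := by
  obtain ⟨k, rfl⟩ := Nat.exists_eq_add_of_le' hj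
  rw [Nat.add_sub_cancel]
  have := hNash.1.1.nonempty
  have := hNash.1.2.1.nonempty
  have hsum := isHermitian_mmwuSum hR.1 μ
  have hHA : ∀ i, (μ • (mmwuSum R μ i).1).IsHermitian := fun i =>
    (hsum i).1.smul (IsSelfAdjoint.all μ)
  have hHB : ∀ i, (-μ • (mmwuSum R μ i).2).IsHermitian := fun i =>
    (hsum i).2.smul (IsSelfAdjoint.all (-μ))
  have hρ : ∀ i, IsDensity (mmwuRho R μ i) := fun i => isDensity_traceNormalize_exp (hHA i)
  have hσ : ∀ i, IsDensity (mmwuSigma R μ i) := fun i => isDensity_traceNormalize_exp (hHB i)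
  have hP0 := posSemidef_superOp hR (hσ k).1
  have hP1 := hR1 _ (hσ k)
  have hQ0 := posSemidef_superAdjoint hR (hρ k).1
  have hQ1 := posSemidef_one_sub_superAdjoint hR hR1 (hρ k)
  have hA : μ • (mmwuSum R μ (k + 1)).1 =
      μ • (mmwuSum R μ k).1 + μ • superOp R (mmwuSigma R μ k) := smul_add _ _ _
  have hB : -μ • (mmwuSum R μ (k + 1)).2 =
      -μ • (mmwuSum R μ k).2 + -μ • superAdjoint (superOp R) (mmwuRho R μ k) := smul_add _ _ _
  have hadj : ∀ B, (B * superAdjoint (superOp R) (mmwuRho R μ k)).trace =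
      (mmwuRho R μ k * superOp R B).trace := fun B => by
    rw [trace_mul_comm, trace_superAdjoint_mul hR.1 (hρ k).1.1]
  have hA' : μ • (mmwuSum R μ k).1 =
      μ • (mmwuSum R μ (k + 1)).1 + -μ • superOp R (mmwuSigma R μ k) := by
    rw [hA, neg_smul, add_neg_cancel_right]
  have hB' : -μ • (mmwuSum R μ k).2 =
      -μ • (mmwuSum R μ (k + 1)).2 + μ • superAdjoint (superOp R) (mmwuRho R μ k) := by
    rw [hB, neg_smul, neg_smul, neg_add_cancel_right]
  have upA := log_trace_exp_add_sub_le (hHA k) hP0 hP1 μ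
  have upB := log_trace_exp_add_sub_le (hHB k) hQ0 hQ1 (-μ)
  -- The same update undone from time `k + 1`: signs flip, and the states in the traces become the
  -- new ones.
  have loA := log_trace_exp_add_sub_le (hHA (k + 1)) hP0 hP1 (-μ)
  have loB := log_trace_exp_add_sub_le (hHB (k + 1)) hQ0 hQ1 μ
  rw [← hA] at upA
  rw [← hB] at upB
  rw [← hA'] at loA
  rw [← hB'] at loB
  change _ ≤ _ * (mmwuRho R μ k * _).trace.re at upA
  change _ ≤ _ * (mmwuSigma R μ k * _).trace.re at upB
  change _ ≤ _ * (mmwuRho R μ (k + 1) * _).trace.re at loA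
  change _ ≤ _ * (mmwuSigma R μ (k + 1) * _).trace.re at loB
  rw [hadj] at upB loB
  have entA : ∀ i, quantumRelEntropy ρs (mmwuRho R μ i) = _ := fun i =>
    quantumRelEntropy_traceNormalize_exp hNash.1.1.2 (hHA i)
  have entB : ∀ i, quantumRelEntropy σs (mmwuSigma R μ i) = _ := fun i =>
    quantumRelEntropy_traceNormalize_exp hNash.1.2.1.2 (hHB i)
  -- The increments `+μv` here and `-μv` in `linB`, with `v` the game value, cancel in the sum.
  have linA : (ρs * (μ • (mmwuSum R μ (k + 1)).1)).trace.re =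
      (ρs * (μ • (mmwuSum R μ k).1)).trace.re + μ * payoff R ρs σs := by
    rw [hA, Matrix.mul_add, trace_add, Complex.add_re, mul_smul_comm μ ρs (superOp R _), trace_smul,
      Complex.real_smul, Complex.re_ofReal_mul, hNash.payoff_left (hσ k)]
  have linB : (σs * (-μ • (mmwuSum R μ (k + 1)).2)).trace.re =
      (σs * (-μ • (mmwuSum R μ k).2)).trace.re - μ * payoff R ρs σs := by
    rw [hB, Matrix.mul_add, trace_add, Complex.add_re,
      mul_smul_comm (-μ) σs (superAdjoint (superOp R) _), trace_smul,
      Complex.real_smul, Complex.re_ofReal_mul, hadj, hNash.payoff_right (hρ k), neg_mul,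
      ← sub_eq_add_neg]
  rw [entA, entA, entB, entB, linA, linB]
  constructor <;> linarith
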